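/- Let $k$ be a field and $K\supseteq k$ an algebraically closed extension field. Let $G$ be a linear algebraic $k$-group, i.e. an affine algebraic group over $K$ (identified with its group of $K$-points, with algebra $K[G]$ of regular functions) that is defined over $k$. Then there are a finite dimensional vector space $U$ over $K$ endowed with a $k$-structure and an integer $b\ge 0$ such that the following holds. For every integer $r\ge b$ and every trivial finite dimensional $\mathrm{SL}(U)$-module $L$ over $K$ that is defined over $k$ (i.e. is endowed with a $k$-structure) and satisfies $\dim_K L\ge 2$, the $\mathrm{SL}(U)$-module $(L\oplus U)^{\otimes r}$ contains a $K$-linear subspace $S$ defined over $k$ whose normalizer $$\mathrm{SL}(U)_S=\{g\in \mathrm{SL}(U)\mid g(S)=S\}$$ is a $k$-subgroup of $\mathrm{SL}(U)$ (a closed subgroup defined over $k$) that is $k$-isomorphic to $G$. -/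

import Mathlib

universe u v w x

open scoped TensorProduct

noncomputable section

/-! ### `k`-structures on vector spaces -/

/-- `V₀` is a `k`-structure on the `K`-subspace `V` of `M`: the canonical `K`-linear map
`K ⊗[k] V₀ → M`, `c ⊗ v ↦ c • v`, is injective with image `V`. -/
structure IsKStructure {k K M : Type*} [Field k] [Field K] [Algebra k K] [AddCommGroup M]
    [Module k M] [Module K M] [IsScalarTower k K M]
    (V₀ : Submodule k M) (V : Submodule K M) : Prop where
  injective : Function.Injective (V₀.subtype.liftBaseChange K)
  range_eq : LinearMap.range (V₀.subtype.liftBaseChange K) = V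

/-- With respect to a `k`-structure `V₀`, the `K`-subspace `S` is defined over `k`:
it is spanned over `K` by its `k`-rational vectors. -/
def IsDefinedOver {k K M : Type*} [Field k] [Field K] [AddCommGroup M]
    [Module k M] [Module K M] (V₀ : Submodule k M) (S : Submodule K M) : Prop :=
  Submodule.span K ((V₀ : Set M) ∩ (S : Set M)) = S

/-! ### Affine varieties over `K` with a `k`-structure, and `k`-groups -/

/-- Candidate data for an affine variety over `K` with underlying set `X` and a `k`-structure:
the algebra `K[X]` of regular functions and the algebra `k[X]` of those defined over `k`. -/
structure FunctionAlgebras (k K X : Type*) [Field k] [Field K] [Algebra k K] where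
  /-- The `K`-algebra `K[X]`. -/
  regular : Subalgebra K (X → K)
  /-- The `k`-algebra `k[X]`. -/
  rational : Subalgebra k (X → K)

namespace FunctionAlgebras

variable {k K X : Type*} [Field k] [Field K] [Algebra k K]

/-- Over an algebraically closed field `K`: `X` is an affine variety with algebra of regular
functions `K[X]`, and the finitely generated `k`-algebra `k[X]` is a `k`-structure on it. -/
structure IsAffineKVariety (A : FunctionAlgebras k K X) : Prop where
  /-- `k[X]` is finitely generated over `k`. -/
  fg : A.rational.FG
  /-- `K ⊗[k] k[X] → K[X]` is an isomorphism. -/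
  isKStructure : IsKStructure (Subalgebra.toSubmodule A.rational)
    (Subalgebra.toSubmodule A.regular)
  /-- The points of `X` are exactly the `K`-algebra homomorphisms `K[X] → K`. -/
  points : Function.Bijective
    (fun x : X => ((Pi.evalAlgHom K (fun _ : X => K) x).comp A.regular.val : A.regular →ₐ[K] K))

/-- The `K`-subspace (an ideal of `K[X]`) of regular functions vanishing on `Y`. -/
def vanishing (A : FunctionAlgebras k K X) (Y : Set X) : Submodule K (X → K) where
  carrier := {f | f ∈ A.regular ∧ ∀ y ∈ Y, f y = 0}
  zero_mem' := ⟨A.regular.zero_mem, fun _ _ => rfl⟩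
  add_mem' := fun {f g} hf hg => ⟨A.regular.add_mem hf.1 hg.1, fun y hy => by
    rw [Pi.add_apply, hf.2 y hy, hg.2 y hy, add_zero]⟩
  smul_mem' := fun c f hf => ⟨A.regular.smul_mem hf.1 c, fun y hy => by
    rw [Pi.smul_apply, hf.2 y hy, smul_zero]⟩

/-- `Y` is a Zariski closed subset of `X`. -/
def IsClosedSubset (A : FunctionAlgebras k K X) (Y : Set X) : Prop :=
  ∀ x : X, (∀ f ∈ A.vanishing Y, f x = 0) → x ∈ Y

/-- `Y` is a closed subvariety of `X` defined over `k`: it is closed and its ideal in `K[X]`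
is spanned over `K` by elements of `k[X]`. -/
def IsClosedOver (A : FunctionAlgebras k K X) (Y : Set X) : Prop :=
  A.IsClosedSubset Y ∧ IsDefinedOver (Subalgebra.toSubmodule A.rational) (A.vanishing Y)

/-- The induced algebras of functions on a subset `Y` of `X`: restrictions to `Y` of the
elements of `K[X]` and of `k[X]`. -/
def restrict (A : FunctionAlgebras k K X) (Y : Set X) : FunctionAlgebras k K Y where
  regular := A.regular.map (AlgHom.pi fun y => Pi.evalAlgHom K _ y.1)
  rational := A.rational.map (AlgHom.pi fun y => Pi.evalAlgHom k _ y.1)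

/-- The functions on `X × X` defined over `k`, that is, the image of `k[X] ⊗[k] k[X]`. -/
def rationalProd (A : FunctionAlgebras k K X) : Submodule k (X × X → K) :=
  Submodule.span k {F | ∃ a ∈ A.rational, ∃ b ∈ A.rational, F = fun p => a p.1 * b p.2}

/-- `G` with these algebras of functions is an algebraic `k`-group: an affine variety with a
`k`-structure such that the multiplication and the inversion are morphisms defined over `k` and
the identity element is a `k`-rational point. -/
structure IsAlgebraicKGroup {G : Type*} [Group G] (A : FunctionAlgebras k K G) : Prop
    extends A.IsAffineKVariety where
  mul_mem : ∀ f ∈ A.rational, (fun p : G × G => f (p.1 * p.2)) ∈ A.rationalProd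
  inv_mem : ∀ f ∈ A.rational, (fun x : G => f x⁻¹) ∈ A.rational
  one_mem : ∀ f ∈ A.rational, f 1 ∈ Set.range (algebraMap k K)

/-- A subgroup is a `k`-subgroup: it is a closed subvariety defined over `k`. -/
def IsKSubgroup {G : Type*} [Group G] (A : FunctionAlgebras k K G) (H : Subgroup G) : Prop :=
  A.IsClosedOver (H : Set G)

/-- A group isomorphism is a `k`-isomorphism: its comorphism `f ↦ f ∘ φ` carries `K[G]` onto
`K[H]` and `k[G]` onto `k[H]`. -/
structure IsKIsomorphism {H G : Type*} [Group H] [Group G] (B : FunctionAlgebras k K H)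
    (A : FunctionAlgebras k K G) (φ : H ≃* G) : Prop where
  regular_iff : ∀ f : G → K, f ∘ φ ∈ B.regular ↔ f ∈ A.regular
  rational_iff : ∀ f : G → K, f ∘ φ ∈ B.rational ↔ f ∈ A.rational

end FunctionAlgebras

/-! ### The group `SL(U)` and its modules -/

/-- The algebras of functions on `SL(U)`, for a finite dimensional `U` with `k`-structure `U₀`:
`K[SL(U)]` is generated by the matrix coefficients `g ↦ l (g u)`, and `k[SL(U)]` by those where
the vector `u` and the linear form `l` are `k`-rational. -/
def slFunctions {k K U : Type*} [Field k] [Field K] [Algebra k K] [AddCommGroup U]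
    [Module k U] [Module K U] (U₀ : Submodule k U) :
    FunctionAlgebras k K (SpecialLinearGroup K U) where
  regular := Algebra.adjoin K {F | ∃ (l : Module.Dual K U) (u : U), F = fun g => l (g u)}
  rational := Algebra.adjoin k {F | ∃ (l : Module.Dual K U) (u : U), u ∈ U₀ ∧
    (∀ w ∈ U₀, l w ∈ Set.range (algebraMap k K)) ∧ F = fun g => l (g u)}

/-- The tautological `SL(U)`-module `U`. -/
def slStandard (K U : Type*) [Field K] [AddCommGroup U] [Module K U] :
    Representation K (SpecialLinearGroup K U) U where
  toFun g := (g.1 : U →ₗ[K] U)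
  map_one' := rfl
  map_mul' _ _ := rfl

/-- The `r`-th tensor power of a representation. -/
def Representation.tensorPow {K G V : Type*} [Field K] [Group G] [AddCommGroup V] [Module K V]
    (ρ : Representation K G V) (r : ℕ) : Representation K G (⨂[K] _ : Fin r, V) where
  toFun g := PiTensorProduct.map fun _ => ρ g
  map_one' := by
    rw [map_one]
    exact PiTensorProduct.map_one
  map_mul' g h := by
    rw [map_mul]
    exact PiTensorProduct.map_mul (fun _ => ρ g) (fun _ => ρ h)

/-- The `k`-structure on `V^{⊗r}` induced by the `k`-structure `V₀` on `V`: the image of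
`V₀^{⊗r}`, spanned over `k` by the tensor products of `k`-rational vectors. -/
def tensorPowRational {k : Type*} (K : Type*) {V : Type*} [Field k] [Field K] [Algebra k K]
    [AddCommGroup V] [Module k V] [Module K V] (V₀ : Submodule k V) (r : ℕ) :
    Submodule k (⨂[K] _ : Fin r, V) :=
  Submodule.span k {t | ∃ v : Fin r → V, (∀ i, v i ∈ V₀) ∧ t = PiTensorProduct.tprod K v}

/-- The normalizer `G_S = {g ∈ G | g(S) = S}` of a linear subspace `S` of a `G`-module. -/
def Representation.normalizer {K G V : Type*} [Field K] [Group G] [AddCommGroup V] [Module K V]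
    (ρ : Representation K G V) (S : Submodule K V) : Subgroup G where
  carrier := {g | S.map (ρ g) = S}
  one_mem' := by
    show S.map (ρ 1) = S
    rw [map_one]
    exact Submodule.map_id S
  mul_mem' := fun {g h} hg hh => by
    show S.map (ρ (g * h)) = S
    have hg' : S.map (ρ g) = S := hg
    have hh' : S.map (ρ h) = S := hh
    rw [map_mul, Module.End.mul_eq_comp, Submodule.map_comp, hh', hg']
  inv_mem' := fun {g} hg => by
    show S.map (ρ g⁻¹) = S
    have hg' : S.map (ρ g) = S := hg
    conv_lhs => rw [← hg']
    rw [← Submodule.map_comp, ← Module.End.mul_eq_comp, ← map_mul, inv_mul_cancel, map_one]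
    exact Submodule.map_id S

end

noncomputable section

/-! ### Linear algebra of `k`-structures -/

section KStructure

variable {k K M N : Type*} [Field k] [Field K] [Algebra k K] [AddCommGroup M]
  [Module k M] [Module K M] [IsScalarTower k K M] [AddCommGroup N]
  [Module k N] [Module K N] [IsScalarTower k K N]

theorem range_liftBaseChange_subtype (V₀ : Submodule k M) :
    LinearMap.range (V₀.subtype.liftBaseChange K) = Submodule.span K (V₀ : Set M) := by
  apply le_antisymm
  · rintro _ ⟨z, rfl⟩
    induction z with
    | zero => simp
    | add x y hx hy => rw [map_add]; exact add_mem hx hy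
    | tmul c v => exact Submodule.smul_mem _ _ (Submodule.subset_span v.2)
  · rw [Submodule.span_le]
    intro v hv
    exact ⟨1 ⊗ₜ ⟨v, hv⟩, by simp⟩

namespace IsKStructure

variable {V₀ : Submodule k M} {V : Submodule K M} {ι : Type*}

theorem span_eq (h : IsKStructure V₀ V) : Submodule.span K (V₀ : Set M) = V := by
  rw [← range_liftBaseChange_subtype, h.range_eq]

theorem mem (h : IsKStructure V₀ V) {v : M} (hv : v ∈ V₀) : v ∈ V :=
  h.span_eq ▸ Submodule.subset_span hv

/-- The `K`-linear extension `K ⊗[k] V₀ ≃ V` of the inclusion of a `k`-structure. -/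
def equiv (h : IsKStructure V₀ V) : K ⊗[k] V₀ ≃ₗ[K] V :=
  (LinearEquiv.ofInjective _ h.injective).trans (LinearEquiv.ofEq _ _ h.range_eq)

theorem coe_equiv_tmul (h : IsKStructure V₀ V) (c : K) (v : V₀) :
    (h.equiv (c ⊗ₜ v) : M) = c • (v : M) := rfl

/-- A `k`-basis of a `k`-structure is a `K`-basis of the ambient space. -/
def basis (h : IsKStructure V₀ V) (e : Module.Basis ι k V₀) : Module.Basis ι K V :=
  (e.baseChange K).map h.equiv

theorem basis_repr (h : IsKStructure V₀ V) (e : Module.Basis ι k V₀) (v : V₀) (i : ι) :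
    (h.basis e).repr ⟨v, h.mem v.2⟩ i = algebraMap k K (e.repr v i) := by
  have : (⟨v, h.mem v.2⟩ : V) = h.equiv (1 ⊗ₜ v) := by
    ext; simp [coe_equiv_tmul]
  rw [this, basis, Module.Basis.map_repr, LinearEquiv.trans_apply, LinearEquiv.symm_apply_apply,
    Module.Basis.baseChange_repr_tmul, Algebra.algebraMap_eq_smul_one]

theorem linearIndependent (h : IsKStructure V₀ V) {v : ι → M} (hv : ∀ i, v i ∈ V₀)
    (hli : LinearIndependent k v) : LinearIndependent K v := by
  have h0 : LinearIndependent k (fun i => (⟨v i, hv i⟩ : V₀)) :=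
    LinearIndependent.of_comp V₀.subtype hli
  have h1 : LinearIndependent K (fun i => (1 : K) ⊗ₜ[k] (⟨v i, hv i⟩ : V₀)) := by
    let e := Module.Basis.extend h0.linearIndepOn_id
    have := (e.baseChange K).linearIndependent.comp
      (fun i : ι => (⟨⟨v i, hv i⟩, Module.Basis.subset_extend _ ⟨i, rfl⟩⟩ :
        h0.linearIndepOn_id.extend (Set.subset_univ _)))
      (fun i j hij => h0.injective (congrArg Subtype.val hij))
    convert this using 1
    funext i
    simp [e]
  have h2 := (h1.map' h.equiv.toLinearMap h.equiv.ker).map' V.subtype V.ker_subtype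
  have hfun : (V.subtype ∘ h.equiv.toLinearMap ∘ fun i => (1 : K) ⊗ₜ[k] (⟨v i, hv i⟩ : V₀)) = v :=
    funext fun i => one_smul K (v i)
  rwa [hfun] at h2

end IsKStructure

theorem Module.Basis.isKStructure_span {ι : Type*} (b : Module.Basis ι K M) :
    IsKStructure (Submodule.span k (Set.range b)) (⊤ : Submodule K M) where
  injective := by
    have hli : LinearIndependent k b := b.linearIndependent.restrict_scalars' k
    let e := (Module.Basis.span hli).baseChange K
    have he : ((Submodule.span k (Set.range b)).subtype.liftBaseChange K) =
        (e.equiv b (Equiv.refl ι)).toLinearMap := by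
      apply e.ext
      intro i
      rw [LinearEquiv.coe_coe, Module.Basis.equiv_apply, Module.Basis.baseChange_apply,
        LinearMap.liftBaseChange_tmul, one_smul, Submodule.subtype_apply, Module.Basis.span_apply,
        Equiv.refl_apply]
    rw [he]
    exact (e.equiv b (Equiv.refl ι)).injective
  range_eq := by
    rw [range_liftBaseChange_subtype, Submodule.span_span_of_tower, b.span_eq]

/-- If a `K`-linear map sends `k`-rational vectors to a `k`-structure, its kernel is spanned by
`k`-rational vectors. -/
theorem mem_span_inter_ker {V₀ : Submodule k M} {N₀ : Submodule k N}
    (hN : Function.Injective (N₀.subtype.liftBaseChange K)) (T : M →ₗ[K] N)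
    (hT : ∀ v ∈ V₀, T v ∈ N₀) {t : M} (ht : t ∈ Submodule.span K (V₀ : Set M)) (h0 : T t = 0) :
    t ∈ Submodule.span K ((V₀ : Set M) ∩ (LinearMap.ker T : Set M)) := by
  rw [← range_liftBaseChange_subtype] at ht
  obtain ⟨z, rfl⟩ := ht
  let T₀ : V₀ →ₗ[k] N₀ := (T.restrictScalars k).restrict hT
  have hcomm : ∀ z, N₀.subtype.liftBaseChange K (T₀.lTensor K z) =
      T (V₀.subtype.liftBaseChange K z) := by
    intro z
    induction z with
    | zero => simp
    | add x y hx hy => rw [map_add, map_add, hx, hy, map_add, map_add]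
    | tmul c v => exact (T.map_smul c (v : M)).symm
  have hz : T₀.lTensor K z = 0 := hN (by rw [hcomm, h0, map_zero])
  obtain ⟨w, rfl⟩ := (Module.Flat.lTensor_exact K
    (LinearMap.exact_subtype_ker_map T₀) z).1 hz
  clear hz h0
  induction w with
  | zero => simp
  | add x y hx hy => rw [map_add, map_add]; exact add_mem hx hy
  | tmul c v =>
    refine Submodule.smul_mem _ _ (Submodule.subset_span ⟨v.1.2, ?_⟩)
    exact congrArg Subtype.val (LinearMap.mem_ker.1 v.2)

end KStructure

/-! ### Embedding a `k`-group into a special linear group -/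

theorem IsKStructure.exists_dual_family {k K M : Type*} [Field k] [Field K] [Algebra k K]
    [AddCommGroup M] [Module k M] [Module K M] [IsScalarTower k K M] {V₀ : Submodule k M}
    {V : Submodule K M} (h : IsKStructure V₀ V) {ι : Type*} (e : Module.Basis ι k V₀) :
    ∃ c : ι → Module.Dual K M, ∀ i, ∀ v : V₀, c i v = algebraMap k K (e.repr v i) := by
  have (i : ι) : ∃ c : Module.Dual K M, ∀ v : V₀, c v = algebraMap k K (e.repr v i) := by
    obtain ⟨c, hc⟩ := LinearMap.exists_extend ((h.basis e).coord i)
    refine ⟨c, fun v => ?_⟩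
    rw [← h.basis_repr e v i]
    exact LinearMap.congr_fun hc ⟨v, h.mem v.2⟩
  exact ⟨fun i => (this i).choose, fun i => (this i).choose_spec⟩

namespace FunctionAlgebras

variable {k K : Type*} [Field k] [Field K] [Algebra k K] {G : Type*}

/-- The functions `(x, y) ↦ ∑ a i x * b i y` on `G × G` with `a i ∈ W` and `b i ∈ k[G]`. -/
def prodSpan (A : FunctionAlgebras k K G) (W : Submodule k (G → K)) : Submodule k (G × G → K) :=
  Submodule.span k {F | ∃ a ∈ W, ∃ b ∈ A.rational, F = fun p => a p.1 * b p.2}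

theorem prodSpan_mono (A : FunctionAlgebras k K G) {W W' : Submodule k (G → K)} (h : W ≤ W') :
    A.prodSpan W ≤ A.prodSpan W' :=
  Submodule.span_mono fun _ ⟨a, ha, b, hb, hF⟩ => ⟨a, h ha, b, hb, hF⟩

theorem exists_sum_of_mem_prodSpan {A : FunctionAlgebras k K G} {W : Submodule k (G → K)}
    {F : G × G → K} (hF : F ∈ A.prodSpan W) :
    ∃ (n : ℕ) (a b : Fin n → G → K), (∀ m, a m ∈ W) ∧ (∀ m, b m ∈ A.rational) ∧
      ∀ x y, F (x, y) = ∑ m, a m x * b m y := by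
  obtain ⟨n, c, g, rfl⟩ := (Submodule.mem_span_set' ..).1 hF
  choose a ha b hb h using fun m => (g m).2
  refine ⟨n, fun m => c m • a m, b, fun m => W.smul_mem _ (ha m), hb, fun x y => ?_⟩
  simp [h, Finset.sum_apply]

theorem exists_basis_expansion {A : FunctionAlgebras k K G} {W : Submodule k (G → K)}
    {ι : Type*} (e : Module.Basis ι k (Subalgebra.toSubmodule A.rational))
    {F : G × G → K} (hF : F ∈ A.prodSpan W) :
    ∃ (s : Finset ι) (a : ι → G → K), (∀ i, a i ∈ W) ∧
      ∀ x y, F (x, y) = ∑ i ∈ s, a i x * (e i : G → K) y := by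
  classical
  obtain ⟨n, a, b, ha, hb, hab⟩ := exists_sum_of_mem_prodSpan hF
  let b' : Fin n → Subalgebra.toSubmodule A.rational := fun m => ⟨b m, hb m⟩
  let s := Finset.univ.biUnion fun m => (e.repr (b' m)).support
  have hbs : ∀ m y, b m y = ∑ i ∈ s, e.repr (b' m) i • (e i : G → K) y := by
    intro m y
    have h1 : b' m = ∑ i ∈ s, e.repr (b' m) i • e i := by
      conv_lhs => rw [← e.linearCombination_repr (b' m)]
      refine Finsupp.sum_of_support_subset _ ?_ _ (by simp)
      exact Finset.subset_biUnion_of_mem (fun m => (e.repr (b' m)).support) (Finset.mem_univ m)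
    have h2 := congrArg (Subalgebra.toSubmodule A.rational).subtype h1
    rw [map_sum] at h2
    have h3 := congrFun h2 y
    rw [Finset.sum_apply] at h3
    exact h3
  refine ⟨s, fun i => ∑ m, e.repr (b' m) i • a m,
    fun i => sum_mem fun m _ => W.smul_mem _ (ha m), fun x y => ?_⟩
  rw [hab x y]
  simp only [hbs, Finset.mul_sum, Finset.sum_apply, Finset.sum_mul, Pi.smul_apply]
  rw [Finset.sum_comm]
  refine Finset.sum_congr rfl fun i _ => Finset.sum_congr rfl fun m _ => ?_
  rw [mul_smul_comm, smul_mul_assoc]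

theorem slice_mem_of_mem_prodSpan {A : FunctionAlgebras k K G} {W : Submodule k (G → K)}
    {c : Module.Dual K (G → K)} (hc : ∀ b ∈ A.rational, ∃ t : k, c b = algebraMap k K t)
    {F : G × G → K} (hF : F ∈ A.prodSpan W) : (fun y => c fun z => F (y, z)) ∈ W := by
  obtain ⟨n, a, b, ha, hb, hab⟩ := exists_sum_of_mem_prodSpan hF
  choose t ht using fun m => hc (b m) (hb m)
  have : (fun y => c fun z => F (y, z)) = ∑ m, t m • a m := by
    funext y
    have : (fun z => F (y, z)) = ∑ m, a m y • b m := by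
      funext z
      rw [hab, Finset.sum_apply]
      rfl
    rw [this, map_sum, Finset.sum_apply]
    refine Finset.sum_congr rfl fun m _ => ?_
    rw [map_smul, ht, Pi.smul_apply, smul_eq_mul, Algebra.smul_def (t m), mul_comm]
  rw [this]
  exact sum_mem fun m _ => W.smul_mem _ (ha m)

theorem det_mem_of_coeff_mem {n : Type*} [Fintype n] [DecidableEq n] (R : Subalgebra k (G → K))
    (m : G → Matrix n n K) (hm : ∀ i j, (fun g => m g i j) ∈ R) :
    (fun g => (m g).det) ∈ R := by
  have : (fun g => (m g).det) = ∑ σ : Equiv.Perm n,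
      ((Equiv.Perm.sign σ : ℤ) : k) • ∏ i, fun g => m g (σ i) i := by
    funext g
    rw [Matrix.det_apply, Finset.sum_apply]
    refine Finset.sum_congr rfl fun σ _ => ?_
    rw [Pi.smul_apply, Finset.prod_apply, Int.cast_smul_eq_zsmul]
    rfl
  rw [this]
  exact R.sum_mem fun σ _ => R.smul_mem (R.prod_mem fun i _ => hm _ _) _

variable [Group G]

/-- The subspace `W` of `k[G]` is stable under right translations, schematically over `k`. -/
structure IsTranslationStable (A : FunctionAlgebras k K G) (W : Submodule k (G → K)) : Prop where
  le : W ≤ Subalgebra.toSubmodule A.rational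
  mul_mem : ∀ w ∈ W, (fun p : G × G => w (p.1 * p.2)) ∈ A.prodSpan W

theorem IsTranslationStable.sup {A : FunctionAlgebras k K G} {W W' : Submodule k (G → K)}
    (h : A.IsTranslationStable W) (h' : A.IsTranslationStable W') :
    A.IsTranslationStable (W ⊔ W') where
  le := sup_le h.le h'.le
  mul_mem := by
    intro w hw
    obtain ⟨a, ha, b, hb, rfl⟩ := Submodule.mem_sup.1 hw
    exact add_mem (A.prodSpan_mono le_sup_left (h.mul_mem a ha))
      (A.prodSpan_mono le_sup_right (h'.mul_mem b hb))

namespace IsAlgebraicKGroup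

variable {A : FunctionAlgebras k K G}

theorem mul_mem_prodSpan (hA : A.IsAlgebraicKGroup) {f : G → K} (hf : f ∈ A.rational) :
    (fun p : G × G => f (p.1 * p.2)) ∈ A.prodSpan (Subalgebra.toSubmodule A.rational) :=
  hA.mul_mem f hf

theorem exists_translationStable (hA : A.IsAlgebraicKGroup) {f : G → K} (hf : f ∈ A.rational) :
    ∃ W : Submodule k (G → K), W.FG ∧ A.IsTranslationStable W ∧ f ∈ W := by
  classical
  obtain ⟨ι, ⟨e⟩⟩ := Module.Basis.exists_basis k (Subalgebra.toSubmodule A.rational)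
  obtain ⟨c, hc⟩ := hA.isKStructure.exists_dual_family e
  obtain ⟨s, F, hF, hfF⟩ := exists_basis_expansion e (hA.mul_mem_prodSpan hf)
  have hcF : ∀ i ∈ s, ∀ x, F i x = c i (fun z => f (x * z)) := by
    intro i hi x
    have : (fun z => f (x * z)) = ∑ j ∈ s, F j x • (e j : G → K) := by
      funext z
      rw [Finset.sum_apply]
      exact hfF x z
    rw [this, map_sum, Finset.sum_eq_single i]
    · rw [map_smul, hc i (e i), e.repr_self, Finsupp.single_eq_same, map_one, smul_eq_mul, mul_one]
    · intro j _ hj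
      rw [map_smul, hc i (e j), e.repr_self, Finsupp.single_eq_of_ne hj.symm, map_zero, smul_zero]
    · exact fun h => (h hi).elim
  have hce : ∀ i j, (fun y => c i (fun z => (e j : G → K) (y * z))) ∈ A.rational := fun i j =>
    slice_mem_of_mem_prodSpan (fun b hb => ⟨_, hc i ⟨b, hb⟩⟩) (hA.mul_mem_prodSpan (e j).2)
  let W : Submodule k (G → K) := Submodule.span k (F '' s)
  have hFW : ∀ i ∈ s, F i ∈ W := fun i hi => Submodule.subset_span ⟨i, hi, rfl⟩
  refine ⟨W, Submodule.fg_span (s.finite_toSet.image F), ⟨?_, ?_⟩, ?_⟩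
  · rw [Submodule.span_le]
    rintro _ ⟨i, -, rfl⟩
    exact hF i
  · intro w hw
    induction hw using Submodule.span_induction with
    | zero => exact zero_mem _
    | add x y _ _ hx hy => exact add_mem hx hy
    | smul t x _ hx => exact Submodule.smul_mem _ t hx
    | mem w hw =>
      obtain ⟨i, hi, rfl⟩ := hw
      have : (fun p : G × G => F i (p.1 * p.2)) =
          ∑ j ∈ s, fun p : G × G => F j p.1 * c i (fun z => (e j : G → K) (p.2 * z)) := by
        funext p
        have h1 : (fun z => f (p.1 * p.2 * z)) =
            ∑ j ∈ s, F j p.1 • fun z => (e j : G → K) (p.2 * z) := by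
          funext z
          rw [Finset.sum_apply, mul_assoc]
          exact hfF p.1 (p.2 * z)
        rw [hcF i hi, h1, map_sum, Finset.sum_apply]
        exact Finset.sum_congr rfl fun j _ => map_smul _ _ _
      rw [this]
      exact sum_mem fun j hj => Submodule.subset_span ⟨F j, hFW j hj, _, hce i j, rfl⟩
  · choose t ht using fun i => hA.one_mem (e i) (e i).2
    have : f = ∑ i ∈ s, t i • F i := by
      funext x
      rw [← mul_one x, Finset.sum_apply]
      refine (hfF x 1).trans (Finset.sum_congr rfl fun i _ => ?_)
      rw [Pi.smul_apply, Algebra.smul_def, ht, mul_comm, mul_one]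
    rw [this]
    exact sum_mem fun i hi => W.smul_mem _ (hFW i hi)

theorem exists_translationStable_of_finset (hA : A.IsAlgebraicKGroup) (s : Finset (G → K))
    (hs : (s : Set (G → K)) ⊆ A.rational) :
    ∃ W : Submodule k (G → K), W.FG ∧ A.IsTranslationStable W ∧ (s : Set (G → K)) ⊆ W := by
  classical
  induction s using Finset.induction_on with
  | empty =>
    refine ⟨⊥, Submodule.fg_bot, ⟨bot_le, fun w hw => ?_⟩, by simp⟩
    rw [(Submodule.mem_bot k).1 hw]
    exact zero_mem _
  | insert f s _ ih =>
    rw [Finset.coe_insert, Set.insert_subset_iff] at hs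
    obtain ⟨W, hW, hstab, hsW⟩ := ih hs.2
    obtain ⟨W', hW', hstab', hfW'⟩ := hA.exists_translationStable hs.1
    refine ⟨W ⊔ W', hW.sup hW', hstab.sup hstab', ?_⟩
    rw [Finset.coe_insert, Set.insert_subset_iff]
    exact ⟨Submodule.mem_sup_right hfW', fun g hg => Submodule.mem_sup_left (hsW hg)⟩

/-- A `k`-group has a matrix representation over `k` whose coefficients generate `k[G]`. -/
theorem exists_matrix_representation (hA : A.IsAlgebraicKGroup) :
    ∃ (n : ℕ) (m : G →* Matrix (Fin n) (Fin n) K),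
      (∀ i j, (fun g => m g i j) ∈ A.rational) ∧
      A.rational ≤ Algebra.adjoin k {F | ∃ i j, F = fun g => m g i j} := by
  classical
  obtain ⟨s, hs⟩ := hA.fg
  obtain ⟨W, hW, hstab, hsW⟩ := hA.exists_translationStable_of_finset s
    (hs ▸ Algebra.subset_adjoin)
  have : Module.Finite k W := Module.Finite.iff_fg.2 hW
  let w := Module.finBasis k W
  have hwR : ∀ i, (w i : G → K) ∈ A.rational := fun i => hstab.le (w i).2
  have hli : LinearIndependent K fun i => (w i : G → K) :=
    hA.isKStructure.linearIndependent hwR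
      (w.linearIndependent.map' W.subtype W.ker_subtype)
  have key : ∀ i, ∃ c : Fin (Module.finrank k W) → G → K, (∀ l, c l ∈ A.rational) ∧
      ∀ x y, (w i : G → K) (x * y) = ∑ l, (w l : G → K) x * c l y := by
    intro i
    obtain ⟨n, a, b, ha, hb, hab⟩ := exists_sum_of_mem_prodSpan (hstab.mul_mem (w i) (w i).2)
    refine ⟨fun l => ∑ m, w.repr ⟨a m, ha m⟩ l • b m,
      fun l => Subalgebra.sum_mem _ fun m _ => A.rational.smul_mem (hb m) _, fun x y => ?_⟩
    have h1 : ∀ m, a m x = ∑ l, w.repr ⟨a m, ha m⟩ l • (w l : G → K) x := by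
      intro m
      have h2 := congrArg W.subtype (w.sum_repr ⟨a m, ha m⟩)
      rw [map_sum] at h2
      have h3 := congrFun h2 x
      rw [Finset.sum_apply] at h3
      exact h3.symm
    rw [hab x y]
    simp only [h1, Finset.mul_sum, Finset.sum_apply, Finset.sum_mul, Pi.smul_apply]
    rw [Finset.sum_comm]
    refine Finset.sum_congr rfl fun l _ => Finset.sum_congr rfl fun m _ => ?_
    rw [mul_smul_comm, smul_mul_assoc]
  choose c hcR hc using key
  have huniq : ∀ (p q : Fin (Module.finrank k W) → K),
      (∀ x, ∑ l, (w l : G → K) x * p l = ∑ l, (w l : G → K) x * q l) → p = q := by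
    intro p q h
    have h1 := Fintype.linearIndependent_iff.1 hli (p - q) (by
      funext x
      have := h x
      simp only [Finset.sum_apply, Pi.smul_apply, Pi.sub_apply, smul_eq_mul, sub_mul,
        Finset.sum_sub_distrib, Pi.zero_apply, sub_eq_zero]
      simpa only [mul_comm] using this)
    exact sub_eq_zero.1 (funext h1)
  refine ⟨Module.finrank k W,
    { toFun := fun g => Matrix.of fun l i => c i l g
      map_one' := ?_
      map_mul' := ?_ }, fun i j => hcR j i, ?_⟩
  · ext l i
    refine congrFun (huniq (fun l => c i l 1) (fun l => (1 : Matrix _ _ K) l i) fun x => ?_) l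
    rw [← hc, mul_one]
    simp [Matrix.one_apply]
  · intro y z
    ext l i
    refine congrFun (huniq (fun l => c i l (y * z))
      (fun l => ∑ j, c j l y * c i j z) fun x => ?_) l
    rw [← hc, ← mul_assoc, hc]
    simp only [hc _ x y, Finset.mul_sum, Finset.sum_mul]
    rw [Finset.sum_comm]
    simp only [mul_assoc]
  · rw [← hs]
    refine Algebra.adjoin_le fun f hf => ?_
    have hW' : W ≤ Subalgebra.toSubmodule
        (Algebra.adjoin k {F : G → K | ∃ i j, F = fun g => c j i g}) := by
      intro f hf
      have h1 := congrArg Subtype.val (w.sum_repr ⟨f, hf⟩)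
      rw [← show _ = f from h1]
      simp only [Submodule.coe_sum, Submodule.coe_smul]
      refine sum_mem fun i _ => Submodule.smul_mem _ _ ?_
      choose t ht using fun l => hA.one_mem (w l) (hwR l)
      have h2 : (w i : G → K) = ∑ l, t l • c i l := by
        funext y
        have := hc i 1 y
        rw [one_mul] at this
        rw [this, Finset.sum_apply]
        refine Finset.sum_congr rfl fun l _ => ?_
        rw [Pi.smul_apply, Algebra.smul_def, ht]
      rw [h2]
      exact sum_mem fun l _ => Submodule.smul_mem _ _ (Algebra.subset_adjoin ⟨l, i, rfl⟩)
    exact hW' (hsW hf)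

/-- A `k`-group has a representation in a special linear group over `k` whose coefficients
generate `k[G]`. -/
theorem exists_special_linear_representation (hA : A.IsAlgebraicKGroup) :
    ∃ (ι : Type) (_ : Fintype ι) (_ : DecidableEq ι)
      (σ : G →* SpecialLinearGroup K (ι → K)),
      (∀ i j, (fun g => σ g (Pi.single j 1) i) ∈ A.rational) ∧
      A.rational ≤ Algebra.adjoin k {F | ∃ i j, F = fun g => σ g (Pi.single j 1) i} := by
  obtain ⟨n, m, hm, hgen⟩ := hA.exists_matrix_representation
  have hdet : (fun g => (m g⁻¹).det) ∈ A.rational :=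
    det_mem_of_coeff_mem _ (fun g => m g⁻¹) fun i j => hA.inv_mem _ (hm i j)
  let M : G →* Matrix.SpecialLinearGroup (Fin n ⊕ Unit) K :=
    { toFun := fun g => ⟨Matrix.fromBlocks (m g) 0 0 (Matrix.of fun _ _ => (m g⁻¹).det), by
        rw [Matrix.det_fromBlocks_zero₂₁, Matrix.det_unique (n := Unit), Matrix.of_apply, ← Matrix.det_mul,
          ← map_mul, mul_inv_cancel, map_one, Matrix.det_one]⟩
      map_one' := by
        apply Subtype.ext
        rw [Matrix.SpecialLinearGroup.coe_one, ← Matrix.fromBlocks_one]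
        simp only [inv_one, map_one, Matrix.det_one]
        rfl
      map_mul' := fun g h => by
        apply Subtype.ext
        change _ = Matrix.fromBlocks (m g) 0 0 _ * Matrix.fromBlocks (m h) 0 0 _
        rw [Matrix.fromBlocks_multiply]
        simp only [map_mul, mul_inv_rev, Matrix.det_mul, Matrix.mul_zero, Matrix.zero_mul,
          add_zero, zero_add]
        congr 1
        ext i j
        simp [Matrix.mul_apply, mul_comm] }
  have hM : ∀ g i j, (Matrix.SpecialLinearGroup.toLin'_equiv (M g)) (Pi.single j 1) i =
      (M g).1 i j := by
    intro g i j
    have : (Matrix.SpecialLinearGroup.toLin'_equiv (M g)) (Pi.single j 1) =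
      (M g).1.mulVec (Pi.single j 1) := rfl
    rw [this, Matrix.mulVec_single_one, Matrix.col_apply]
  refine ⟨Fin n ⊕ Unit, inferInstance, inferInstance,
    Matrix.SpecialLinearGroup.toLin'_equiv.toMonoidHom.comp M, fun i j => ?_,
    hgen.trans (Algebra.adjoin_mono ?_)⟩
  · have : (fun g => (M g).1 i j) ∈ A.rational := by
      rcases i with i | i <;> rcases j with j | j
      · exact hm i j
      · exact zero_mem _
      · exact zero_mem _
      · exact hdet
    convert this using 2 with g
    exact hM g i j
  · rintro _ ⟨i, j, rfl⟩
    exact ⟨Sum.inl i, Sum.inl j, funext fun g => (hM g (Sum.inl i) (Sum.inl j)).symm⟩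

end IsAlgebraicKGroup

end FunctionAlgebras

/-! ### Closed embeddings into a special linear group -/

theorem Algebra.adjoin_subset_adjoin_of_tower {k K B : Type*} [CommSemiring k] [CommSemiring K]
    [Algebra k K] [Semiring B] [Algebra k B] [Algebra K B] [IsScalarTower k K B] (s : Set B) :
    (Algebra.adjoin k s : Set B) ⊆ (Algebra.adjoin K s : Set B) := by
  intro f hf
  induction hf using Algebra.adjoin_induction with
  | mem f hf => exact Algebra.subset_adjoin hf
  | algebraMap r =>
    rw [IsScalarTower.algebraMap_apply k K B]
    exact Subalgebra.algebraMap_mem _ _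
  | add f g _ _ hf hg => exact add_mem hf hg
  | mul f g _ _ hf hg => exact mul_mem hf hg

section SpecialLinear

variable {k K : Type*} [Field k] [Field K] [Algebra k K] {ι : Type*}

variable (k K ι) in
/-- The standard `k`-structure on `K^ι`. -/
def piRational [Finite ι] : Submodule k (ι → K) :=
  Submodule.span k (Set.range (Pi.basisFun K ι))

theorem isKStructure_piRational [Finite ι] : IsKStructure (piRational k K ι) (⊤ : Submodule K _) :=
  (Pi.basisFun K ι).isKStructure_span

theorem mem_piRational [Finite ι] {u : ι → K} :
    u ∈ piRational k K ι ↔ ∀ i, u i ∈ Set.range (algebraMap k K) := by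
  rw [piRational, Module.Basis.mem_span_iff_repr_mem]
  simp only [Pi.basisFun_repr]

variable (k K ι) in
/-- The algebras of functions on `SL(K^ι)` for the standard `k`-structure. -/
abbrev slPiFunctions [Finite ι] : FunctionAlgebras k K (SpecialLinearGroup K (ι → K)) :=
  slFunctions (piRational k K ι)

/-- The matrix coefficients on `SL(K^ι)`. -/
def slCoeff [DecidableEq ι] (i j : ι) : SpecialLinearGroup K (ι → K) → K :=
  fun g => g (Pi.single j 1) i

theorem slCoeff_mem_adjoin [DecidableEq ι] (F : Type*) [CommSemiring F] [Algebra F K] (i j : ι) :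
    slCoeff i j ∈ Algebra.adjoin F {F | ∃ i j, F = slCoeff (K := K) (ι := ι) i j} :=
  Algebra.subset_adjoin ⟨i, j, rfl⟩

variable [Fintype ι] [DecidableEq ι]

theorem dual_apply_special_linear (l : Module.Dual K (ι → K)) (u : ι → K) :
    (fun g : SpecialLinearGroup K (ι → K) => l (g u)) =
      ∑ i, ∑ j, (l (Pi.single i 1) * u j) • slCoeff i j := by
  funext g
  have h1 : ∀ (m : (ι → K) →ₗ[K] K) (v : ι → K), m v = ∑ i, v i * m (Pi.single i 1) := by
    intro m v
    conv_lhs => rw [pi_eq_sum_univ' v, map_sum]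
    exact Finset.sum_congr rfl fun i _ => by
      rw [map_smul, smul_eq_mul]
  have h2 : ∀ i, g u i = ∑ j, u j * slCoeff i j g := fun i =>
    h1 ((LinearMap.proj i).comp (g.1 : (ι → K) →ₗ[K] (ι → K))) u
  simp only [h1 l (g u), h2, Finset.sum_apply, Pi.smul_apply, smul_eq_mul, Finset.sum_mul]
  exact Finset.sum_congr rfl fun i _ => Finset.sum_congr rfl fun j _ => by ring

theorem regular_slPiFunctions : (slPiFunctions k K ι).regular =
    Algebra.adjoin K {F | ∃ i j, F = slCoeff (K := K) (ι := ι) i j} := by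
  refine le_antisymm (Algebra.adjoin_le ?_) (Algebra.adjoin_mono ?_)
  · rintro _ ⟨l, u, rfl⟩
    rw [dual_apply_special_linear]
    exact sum_mem fun i _ => sum_mem fun j _ =>
      Subalgebra.smul_mem _ (slCoeff_mem_adjoin K i j) _
  · rintro _ ⟨i, j, rfl⟩
    exact ⟨LinearMap.proj i, Pi.single j 1, rfl⟩

theorem single_mem_piRational (i : ι) : Pi.single i 1 ∈ piRational k K ι := by
  rw [mem_piRational]
  intro j
  rcases eq_or_ne j i with rfl | h
  · exact ⟨1, by simp⟩
  · exact ⟨0, by simp [h]⟩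

theorem rational_slPiFunctions : (slPiFunctions k K ι).rational =
    Algebra.adjoin k {F | ∃ i j, F = slCoeff (K := K) (ι := ι) i j} := by
  refine le_antisymm (Algebra.adjoin_le ?_) (Algebra.adjoin_mono ?_)
  · rintro _ ⟨l, u, hu, hl, rfl⟩
    rw [dual_apply_special_linear]
    refine sum_mem fun i _ => sum_mem fun j _ => ?_
    obtain ⟨s, hs⟩ := hl _ (single_mem_piRational i)
    obtain ⟨t, ht⟩ := mem_piRational.1 hu j
    rw [← hs, ← ht, ← map_mul, algebraMap_smul]
    exact Subalgebra.smul_mem _ (slCoeff_mem_adjoin k i j) _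
  · rintro _ ⟨i, j, rfl⟩
    exact ⟨LinearMap.proj i, Pi.single j 1, single_mem_piRational j,
      fun w hw => mem_piRational.1 hw i, rfl⟩

theorem rational_slPiFunctions_subset {f : SpecialLinearGroup K (ι → K) → K}
    (hf : f ∈ (slPiFunctions k K ι).rational) : f ∈ (slPiFunctions k K ι).regular := by
  rw [rational_slPiFunctions] at hf
  rw [regular_slPiFunctions]
  exact Algebra.adjoin_subset_adjoin_of_tower _ hf

theorem regular_slPiFunctions_le_span :
    Subalgebra.toSubmodule (slPiFunctions k K ι).regular ≤
      Submodule.span K ((slPiFunctions k K ι).rational : Set (SpecialLinearGroup K (ι → K) → K)) := by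
  rw [regular_slPiFunctions, rational_slPiFunctions, Algebra.adjoin_eq_span]
  refine Submodule.span_mono ?_
  exact (Submonoid.closure_le (S := (Algebra.adjoin k
    {F | ∃ i j, F = slCoeff (K := K) (ι := ι) i j}).toSubmonoid)).2 Algebra.subset_adjoin

end SpecialLinear

/-- Precomposition with a map, as an algebra homomorphism between algebras of functions. -/
def compAlgHom (F : Type*) {K X Y : Type*} [CommSemiring F] [CommSemiring K] [Algebra F K]
    (σ : X → Y) : (Y → K) →ₐ[F] (X → K) :=
  AlgHom.pi fun x => Pi.evalAlgHom F (fun _ => K) (σ x)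

namespace FunctionAlgebras

variable {k K G : Type*} [Field k] [Field K] [Algebra k K] [Group G]
  {ι : Type*} [Fintype ι]

/-- A homomorphism to `SL(K^ι)` whose comorphism carries `K[SL]` onto `K[G]` and `k[SL]` onto
`k[G]`. -/
structure IsClosedKEmbedding (A : FunctionAlgebras k K G)
    (σ : G →* SpecialLinearGroup K (ι → K)) : Prop where
  regular_map : (slPiFunctions k K ι).regular.map (compAlgHom K σ) = A.regular
  rational_map : (slPiFunctions k K ι).rational.map (compAlgHom k σ) = A.rational

theorem IsAffineKVariety.regular_eq_adjoin {X : Type*} {A : FunctionAlgebras k K X}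
    (hA : A.IsAffineKVariety) {s : Set (X → K)} (hs : A.rational = Algebra.adjoin k s) :
    A.regular = Algebra.adjoin K s := by
  apply le_antisymm
  · have h : (A.rational : Set (X → K)) ⊆ Algebra.adjoin K s := by
      rw [hs]
      exact Algebra.adjoin_subset_adjoin_of_tower s
    intro f hf
    have hf' : f ∈ Submodule.span K (A.rational : Set (X → K)) := by
      have := hA.isKStructure.span_eq
      exact this.symm ▸ hf
    exact (Submodule.span_le (p := Subalgebra.toSubmodule (Algebra.adjoin K s))).2 h hf'
  · exact Algebra.adjoin_le fun f hf =>
      hA.isKStructure.mem (show f ∈ A.rational from hs ▸ Algebra.subset_adjoin hf)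

theorem IsAlgebraicKGroup.exists_isClosedKEmbedding {A : FunctionAlgebras k K G}
    (hA : A.IsAlgebraicKGroup) : ∃ (ι : Type) (_ : Fintype ι) (_ : DecidableEq ι)
      (σ : G →* SpecialLinearGroup K (ι → K)), A.IsClosedKEmbedding σ := by
  obtain ⟨ι, hι, hι', σ, hσ, hgen⟩ := hA.exists_special_linear_representation
  have him : ∀ φ : (SpecialLinearGroup K (ι → K) → K) → (G → K), (∀ f, φ f = f ∘ σ) →
      φ '' {F | ∃ i j, F = slCoeff (K := K) (ι := ι) i j} =
        {F | ∃ i j, F = fun g => σ g (Pi.single j 1) i} := by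
    intro φ hφ
    ext f
    constructor
    · rintro ⟨_, ⟨i, j, rfl⟩, rfl⟩
      exact ⟨i, j, hφ _⟩
    · rintro ⟨i, j, rfl⟩
      exact ⟨_, ⟨i, j, rfl⟩, hφ _⟩
  have hrat : A.rational = Algebra.adjoin k {F | ∃ i j, F = fun g => σ g (Pi.single j 1) i} := by
    refine le_antisymm hgen (Algebra.adjoin_le ?_)
    rintro _ ⟨i, j, rfl⟩
    exact hσ i j
  refine ⟨ι, hι, hι', σ, ?_, ?_⟩
  · rw [regular_slPiFunctions, AlgHom.map_adjoin, hA.regular_eq_adjoin hrat]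
    congr 1
    exact him (compAlgHom K σ) fun _ => rfl
  · rw [rational_slPiFunctions, AlgHom.map_adjoin, hrat]
    congr 1
    exact him (compAlgHom k σ) fun _ => rfl

namespace IsClosedKEmbedding

variable {A : FunctionAlgebras k K G} {σ : G →* SpecialLinearGroup K (ι → K)}

theorem comp_mem_regular (hσ : A.IsClosedKEmbedding σ) {f : SpecialLinearGroup K (ι → K) → K}
    (hf : f ∈ (slPiFunctions k K ι).regular) : f ∘ σ ∈ A.regular := by
  rw [← hσ.regular_map]
  exact ⟨f, hf, rfl⟩

theorem comp_mem_rational (hσ : A.IsClosedKEmbedding σ) {f : SpecialLinearGroup K (ι → K) → K}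
    (hf : f ∈ (slPiFunctions k K ι).rational) : f ∘ σ ∈ A.rational := by
  rw [← hσ.rational_map]
  exact ⟨f, hf, rfl⟩

theorem injective (hσ : A.IsClosedKEmbedding σ) (hA : A.IsAffineKVariety) :
    Function.Injective σ := by
  intro g h hgh
  refine hA.points.1 (AlgHom.ext fun f => ?_)
  obtain ⟨F, -, hF⟩ := hσ.regular_map.ge f.2
  have hF' : F ∘ σ = f.1 := hF
  change f.1 g = f.1 h
  rw [← hF', Function.comp_apply, Function.comp_apply, hgh]

/-- The image of a closed embedding is the zero set of finitely many regular functions. -/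
theorem exists_finset_zeros [DecidableEq ι] (hσ : A.IsClosedKEmbedding σ)
    (hA : A.IsAffineKVariety) :
    ∃ s : Finset (SpecialLinearGroup K (ι → K) → K),
      (∀ f ∈ s, f ∈ (slPiFunctions k K ι).regular ∧ ∀ g, f (σ g) = 0) ∧
      ∀ x, (∀ f ∈ s, f x = 0) → x ∈ σ.range := by
  classical
  let R := (slPiFunctions k K ι).regular
  have hnoeth : IsNoetherianRing R := by
    have hfin : {F | ∃ i j, F = slCoeff (K := K) (ι := ι) i j}.Finite :=
      (Set.finite_range fun p : ι × ι => slCoeff (K := K) p.1 p.2).subset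
        fun _ ⟨i, j, h⟩ => ⟨(i, j), h.symm⟩
    have hR : R = Algebra.adjoin K (hfin.toFinset : Set _) := by
      rw [hfin.coe_toFinset]
      exact regular_slPiFunctions
    exact isNoetherianRing_of_fg ⟨hfin.toFinset, hR.symm⟩
  let φ : R →ₐ[K] A.regular := ((compAlgHom K σ).comp R.val).codRestrict A.regular
    fun f => hσ.comp_mem_regular f.2
  have hφ : Function.Surjective φ := by
    intro f
    obtain ⟨F, hF, hFf⟩ := hσ.regular_map.ge f.2
    exact ⟨⟨F, hF⟩, Subtype.ext hFf⟩
  obtain ⟨s, hs⟩ := (isNoetherianRing_iff_ideal_fg R).1 hnoeth (RingHom.ker φ)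
  refine ⟨s.image Subtype.val, ?_, ?_⟩
  · intro f hf
    obtain ⟨F, hF, rfl⟩ := Finset.mem_image.1 hf
    have h1 : F ∈ RingHom.ker φ := hs ▸ Ideal.subset_span hF
    exact ⟨F.2, fun g => congrFun (congrArg Subtype.val (RingHom.mem_ker.1 h1)) g⟩
  · intro x hx
    let ev : R →ₐ[K] K := (Pi.evalAlgHom K (fun _ => K) x).comp R.val
    have hker : RingHom.ker φ ≤ RingHom.ker ev := by
      rw [← hs, Ideal.span_le]
      exact fun f hf => RingHom.mem_ker.2 (hx f.1 (Finset.mem_image_of_mem _ hf))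
    let ψ : A.regular →ₐ[K] K :=
      (Ideal.Quotient.liftₐ (RingHom.ker φ) ev fun a ha => hker ha).comp
        (Ideal.quotientKerAlgEquivOfSurjective hφ).symm.toAlgHom
    have hψ : ∀ f, ψ (φ f) = f.1 x := by
      intro f
      have : (Ideal.quotientKerAlgEquivOfSurjective hφ).symm (φ f) = Ideal.Quotient.mk _ f := by
        rw [AlgEquiv.symm_apply_eq]
        rfl
      change Ideal.Quotient.liftₐ (RingHom.ker φ) ev (fun a ha => hker ha)
        ((Ideal.quotientKerAlgEquivOfSurjective hφ).symm (φ f)) = _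
      rw [this]
      rfl
    obtain ⟨g, hg⟩ := hA.points.2 ψ
    refine ⟨g, ?_⟩
    have hcoeff : ∀ i j, slCoeff i j (σ g) = slCoeff i j x := by
      intro i j
      have hmem : slCoeff i j ∈ R := by
        rw [show R = _ from regular_slPiFunctions]
        exact slCoeff_mem_adjoin K i j
      exact (AlgHom.congr_fun hg (φ ⟨slCoeff i j, hmem⟩)).trans (hψ ⟨slCoeff i j, hmem⟩)
    apply SpecialLinearGroup.ext
    intro v
    refine LinearMap.congr_fun (f := ((σ g).1 : (ι → K) →ₗ[K] (ι → K)))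
      (g := (x.1 : (ι → K) →ₗ[K] (ι → K))) ((Pi.basisFun K ι).ext fun j => ?_) v
    rw [Pi.basisFun_apply]
    exact funext fun i => hcoeff i j

theorem isKSubgroup_range [DecidableEq ι] (hσ : A.IsClosedKEmbedding σ)
    (hA : A.IsAffineKVariety) : (slPiFunctions k K ι).IsKSubgroup σ.range := by
  constructor
  · obtain ⟨s, hs, hzero⟩ := hσ.exists_finset_zeros hA
    intro x hx
    refine hzero x fun f hf => hx f ⟨(hs f hf).1, ?_⟩
    rintro _ ⟨g, rfl⟩
    exact (hs f hf).2 g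
  · refine le_antisymm (Submodule.span_le.2 Set.inter_subset_right) fun f hf => ?_
    have h1 := mem_span_inter_ker hA.isKStructure.injective (compAlgHom K σ).toLinearMap
      (V₀ := Subalgebra.toSubmodule (slPiFunctions k K ι).rational)
      (fun v hv => hσ.comp_mem_rational hv) (regular_slPiFunctions_le_span hf.1)
      (funext fun g => hf.2 _ ⟨g, rfl⟩)
    refine Submodule.span_mono ?_ h1
    rintro F ⟨hF, hF0⟩
    refine ⟨hF, rational_slPiFunctions_subset hF, ?_⟩
    rintro _ ⟨g, rfl⟩
    exact congrFun (LinearMap.mem_ker.1 hF0) g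

theorem exists_isKIsomorphism (hσ : A.IsClosedKEmbedding σ) (hA : A.IsAffineKVariety)
    {H : Subgroup (SpecialLinearGroup K (ι → K))} (hH : H = σ.range) :
    ∃ φ : H ≃* G, IsKIsomorphism ((slPiFunctions k K ι).restrict (H : Set _)) A φ := by
  subst hH
  let e := MonoidHom.ofInjective (hσ.injective hA)
  have he : ∀ h : σ.range, σ (e.symm h) = h := fun h =>
    congrArg Subtype.val (e.apply_symm_apply h)
  refine ⟨e.symm, fun f => ?_, fun f => ?_⟩
  · rw [← hσ.regular_map]
    constructor
    · rintro ⟨F, hF, hFf⟩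
      refine ⟨F, hF, funext fun g => ?_⟩
      have := congrFun hFf (e g)
      exact this.trans (congrArg f (e.symm_apply_apply g))
    · rintro ⟨F, hF, rfl⟩
      exact ⟨F, hF, funext fun h => (congrArg F (he h)).symm⟩
  · rw [← hσ.rational_map]
    constructor
    · rintro ⟨F, hF, hFf⟩
      refine ⟨F, hF, funext fun g => ?_⟩
      have := congrFun hFf (e g)
      exact this.trans (congrArg f (e.symm_apply_apply g))
    · rintro ⟨F, hF, rfl⟩
      exact ⟨F, hF, funext fun h => (congrArg F (he h)).symm⟩

end IsClosedKEmbedding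

end FunctionAlgebras

/-! ### Regular functions as coefficients of tensor powers -/

section Spanning

variable {k K : Type*} [Field k] [Field K]

theorem span_prod_eq_top {M N : Type*} [AddCommGroup M] [Module k M] [Module K M]
    [AddCommGroup N] [Module k N] [Module K N] {M₀ : Submodule k M} {N₀ : Submodule k N}
    (hM : Submodule.span K (M₀ : Set M) = ⊤) (hN : Submodule.span K (N₀ : Set N) = ⊤) :
    Submodule.span K (M₀.prod N₀ : Set (M × N)) = ⊤ := by
  rw [eq_top_iff, ← Submodule.prod_top, ← hM, ← hN]
  rintro ⟨m, n⟩ ⟨hm, hn⟩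
  have h1 : Submodule.span K (M₀ : Set M) ≤
      (Submodule.span K (M₀.prod N₀ : Set (M × N))).comap (LinearMap.inl K M N) :=
    Submodule.span_le.2 fun m hm => Submodule.subset_span ⟨hm, N₀.zero_mem⟩
  have h2 : Submodule.span K (N₀ : Set N) ≤
      (Submodule.span K (M₀.prod N₀ : Set (M × N))).comap (LinearMap.inr K M N) :=
    Submodule.span_le.2 fun n hn => Submodule.subset_span ⟨M₀.zero_mem, hn⟩
  have h3 : (m, (0 : N)) ∈ Submodule.span K (M₀.prod N₀ : Set (M × N)) := h1 hm
  have h4 : ((0 : M), n) ∈ Submodule.span K (M₀.prod N₀ : Set (M × N)) := h2 hn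
  have h5 := add_mem h3 h4
  rwa [Prod.mk_add_mk, add_zero, zero_add] at h5

theorem span_tensorPowRational [Algebra k K] {V : Type*} [AddCommGroup V] [Module k V] [Module K V]
    {V₀ : Submodule k V} (hV : Submodule.span K (V₀ : Set V) = ⊤) (r : ℕ) :
    Submodule.span K (tensorPowRational K V₀ r : Set (⨂[K] _ : Fin r, V)) = ⊤ := by
  set Q := Submodule.span K (tensorPowRational K V₀ r : Set (⨂[K] _ : Fin r, V))
  have hmulti : Q.mkQ.compMultilinearMap (PiTensorProduct.tprod K) = 0 := by
    refine Module.Basis.ext_multilinear (fun _ => Module.Basis.ofSpan hV.ge) fun v => ?_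
    refine (Submodule.Quotient.mk_eq_zero Q).2 (Submodule.subset_span (Submodule.subset_span
      ⟨_, fun i => ?_, rfl⟩))
    exact Module.Basis.ofSpan_subset hV.ge ⟨v i, rfl⟩
  have h0 : Q.mkQ = 0 := PiTensorProduct.ext hmulti
  rw [← Submodule.ker_mkQ Q, h0, LinearMap.ker_zero]

end Spanning

section MatrixMonomials

variable {k K : Type*} [Field k] [Field K] [Algebra k K] {ι : Type*} [DecidableEq ι]

/-- The matrix coefficients of `K ⊕ K^ι`, with `SL(K^ι)` acting trivially on `K`. -/
def slCoeffOption : Option ι → Option ι → SpecialLinearGroup K (ι → K) → K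
  | none, none => 1
  | some i, some j => slCoeff i j
  | _, _ => 0

theorem mem_span_slCoeffOption_pow {f : SpecialLinearGroup K (ι → K) → K} {d : ℕ}
    (hf : f ∈ Submodule.span K {F | ∃ a b, F = slCoeffOption (K := K) (ι := ι) a b} ^ d) :
    f ∈ Submodule.span K
      {F | ∃ a b : Fin d → Option ι, F = fun g => ∏ m, slCoeffOption (a m) (b m) g} := by
  rw [Submodule.span_pow] at hf
  refine Submodule.span_mono ?_ hf
  intro F hF
  obtain ⟨c, rfl⟩ := Set.mem_pow.1 hF
  choose a b hab using fun m => (c m).2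
  refine ⟨a, b, funext fun g => ?_⟩
  rw [List.prod_ofFn, Finset.prod_apply]
  exact Finset.prod_congr rfl fun m _ => congrFun (hab m) g

variable [Fintype ι]

theorem exists_mem_span_slCoeffOption_pow {f : SpecialLinearGroup K (ι → K) → K}
    (hf : f ∈ (slPiFunctions k K ι).regular) : ∃ d, ∀ e, d ≤ e →
      f ∈ Submodule.span K {F | ∃ a b, F = slCoeffOption (K := K) (ι := ι) a b} ^ e := by
  set P := Submodule.span K {F | ∃ a b, F = slCoeffOption (K := K) (ι := ι) a b}
  have h1 : 1 ≤ P := by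
    rw [Submodule.one_le]
    exact Submodule.subset_span ⟨none, none, rfl⟩
  have hmono : ∀ {d e : ℕ}, d ≤ e → P ^ d ≤ P ^ e := fun h => pow_le_pow_right₀ h1 h
  suffices ∃ d, f ∈ P ^ d from this.imp fun d hd e he => hmono he hd
  rw [regular_slPiFunctions] at hf
  induction hf using Algebra.adjoin_induction with
  | mem f hf =>
    obtain ⟨i, j, rfl⟩ := hf
    refine ⟨1, ?_⟩
    rw [pow_one]
    exact Submodule.subset_span ⟨some i, some j, rfl⟩
  | algebraMap c =>
    refine ⟨0, ?_⟩
    rw [pow_zero]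
    exact Submodule.algebraMap_mem c
  | add f g _ _ hf hg =>
    obtain ⟨d, hd⟩ := hf
    obtain ⟨e, he⟩ := hg
    exact ⟨max d e, add_mem (hmono (le_max_left _ _) hd) (hmono (le_max_right _ _) he)⟩
  | mul f g _ _ hf hg =>
    obtain ⟨d, hd⟩ := hf
    obtain ⟨e, he⟩ := hg
    refine ⟨d + e, ?_⟩
    rw [pow_add]
    exact Submodule.mul_mem_mul hd he

theorem exists_common_degree (s : Finset (SpecialLinearGroup K (ι → K) → K))
    (hs : ∀ f ∈ s, f ∈ (slPiFunctions k K ι).regular) : ∃ d, ∀ f ∈ s,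
      f ∈ Submodule.span K
        {F | ∃ a b : Fin d → Option ι, F = fun g => ∏ m, slCoeffOption (a m) (b m) g} := by
  choose! d hd using fun f hf => exists_mem_span_slCoeffOption_pow (k := k) (hs f hf)
  exact ⟨s.sup d, fun f hf => mem_span_slCoeffOption_pow (hd f hf _ (Finset.le_sup hf))⟩

end MatrixMonomials

/-- The tensor product of a family of linear forms. -/
def PiTensorProduct.dualTprod {K V : Type*} [Field K] [AddCommGroup V] [Module K V] {r : ℕ}
    (φ : Fin r → Module.Dual K V) : Module.Dual K (⨂[K] _ : Fin r, V) :=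
  PiTensorProduct.lift ((MultilinearMap.mkPiAlgebra K (Fin r) K).compLinearMap φ)

theorem PiTensorProduct.dualTprod_tprod {K V : Type*} [Field K] [AddCommGroup V] [Module K V]
    {r : ℕ} (φ : Fin r → Module.Dual K V) (v : Fin r → V) :
    dualTprod φ (tprod K v) = ∏ i, φ i (v i) := by
  simp [dualTprod]

theorem IsKStructure.exists_dual_pair {k K L : Type*} [Field k] [Field K] [Algebra k K]
    [AddCommGroup L] [Module k L] [Module K L] [IsScalarTower k K L] {L₀ : Submodule k L}
    (h : IsKStructure L₀ (⊤ : Submodule K L)) (hL : 2 ≤ Module.finrank K L) :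
    ∃ (l : Bool → L) (c : Bool → Module.Dual K L), (∀ i, l i ∈ L₀) ∧
      (∀ i, ∀ v ∈ L₀, c i v ∈ Set.range (algebraMap k K)) ∧
      ∀ i j, c i (l j) = if i = j then 1 else 0 := by
  classical
  obtain ⟨ι, ⟨e⟩⟩ := Module.Basis.exists_basis k L₀
  obtain ⟨c, hc⟩ := h.exists_dual_family e
  have hcard : Module.finrank K L = Nat.card ι := by
    rw [← finrank_top, Module.finrank_eq_nat_card_basis (h.basis e)]
  have hnt : Nontrivial ι := by
    by_contra hnt
    rw [not_nontrivial_iff_subsingleton] at hnt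
    have := Finite.card_le_one_iff_subsingleton.2 hnt
    omega
  obtain ⟨p, q, hpq⟩ := exists_pair_ne ι
  refine ⟨fun i => e (if i then p else q), fun i => c (if i then p else q), fun i => (e _).2,
    fun i v hv => ⟨_, (hc _ ⟨v, hv⟩).symm⟩, fun i j => ?_⟩
  rw [hc, e.repr_self, Finsupp.single_apply]
  cases i <;> cases j <;> simp [hpq, hpq.symm]

/-- For `r` large, matrix monomials of degree `d` are coefficients of `(L ⊕ U)^{⊗r}` with respect
to a single linear form defined over `k`. -/
theorem exists_rational_form {k K : Type*} [Field k] [Field K] [Algebra k K]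
    {ι : Type*} [Fintype ι] [DecidableEq ι] (d m : ℕ)
    (hm : Fintype.card (Fin d → Option ι) ≤ m)
    {L : Type*} [AddCommGroup L] [Module k L] [Module K L] [IsScalarTower k K L]
    {L₀ : Submodule k L} (hL₀ : IsKStructure L₀ (⊤ : Submodule K L))
    (ρ : Representation K (SpecialLinearGroup K (ι → K)) L) (hρ : ρ.IsTrivial)
    (hL : 2 ≤ Module.finrank K L) :
    ∃ Λ : Module.Dual K (⨂[K] _ : Fin (d + m), L × (ι → K)),
      (∀ t ∈ tensorPowRational K (L₀.prod (piRational k K ι)) (d + m),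
        (fun g => Λ ((ρ.prod (slStandard K (ι → K))).tensorPow (d + m) g t)) ∈
          (slPiFunctions k K ι).rational) ∧
      ∀ a b : Fin d → Option ι, ∃ t, ∀ g,
        Λ ((ρ.prod (slStandard K (ι → K))).tensorPow (d + m) g t) =
          ∏ j, slCoeffOption (a j) (b j) g := by
  classical
  obtain ⟨l, c, hl, hc, hcl⟩ := hL₀.exists_dual_pair hL
  let code : (Fin d → Option ι) → ℕ := fun a => (Fintype.equivFin (Fin d → Option ι) a).1
  have hcode : Function.Injective code :=
    Fin.val_injective.comp (Fintype.equivFin (Fin d → Option ι)).injective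
  have hcode_lt : ∀ a, code a < m := fun a =>
    (Fintype.equivFin (Fin d → Option ι) a).2.trans_le hm
  let vec : Option ι → L × (ι → K) := fun o => o.elim (l true, 0) fun j => (0, Pi.single j 1)
  let form : Option ι → Module.Dual K (L × (ι → K)) := fun o =>
    o.elim ((c true).comp (LinearMap.fst K L (ι → K)))
      fun i => (LinearMap.proj i).comp (LinearMap.snd K L (ι → K))
  let v : (Fin d → Option ι) → (Fin d → Option ι) → Fin (d + m) → L × (ι → K) := fun a b =>
    Fin.append (fun j => vec (b j)) fun i : Fin m => (l (decide (i.1 = code a)), 0)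
  let φ : (Fin d → Option ι) → Fin (d + m) → Module.Dual K (L × (ι → K)) := fun a =>
    Fin.append (fun j => form (a j))
      fun i : Fin m => (c (decide (i.1 = code a))).comp (LinearMap.fst K L (ι → K))
  have hact : ∀ g w, (ρ.prod (slStandard K (ι → K))) g w = (w.1, g w.2) := by
    intro g w
    have := hρ.out g
    change (ρ g w.1, g w.2) = _
    rw [this]
    rfl
  have hcoeff : ∀ g a b, form a ((ρ.prod (slStandard K (ι → K))) g (vec b)) =
      slCoeffOption a b g := by
    intro g a b
    rw [hact]
    rcases a with _ | i <;> rcases b with _ | j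
    · exact (hcl true true).trans (if_pos rfl)
    · exact map_zero (c true)
    · exact congrFun (map_zero g.1) i
    · rfl
  let Λ := ∑ a, PiTensorProduct.dualTprod (φ a)
  have hΛ : ∀ g w, Λ ((ρ.prod (slStandard K (ι → K))).tensorPow (d + m) g
      (PiTensorProduct.tprod K w)) =
      ∑ a, ∏ i, φ a i ((ρ.prod (slStandard K (ι → K))) g (w i)) := by
    intro g w
    have : (ρ.prod (slStandard K (ι → K))).tensorPow (d + m) g (PiTensorProduct.tprod K w) =
        PiTensorProduct.tprod K fun i => (ρ.prod (slStandard K (ι → K))) g (w i) :=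
      PiTensorProduct.map_tprod _ _
    rw [this, LinearMap.sum_apply]
    exact Finset.sum_congr rfl fun a _ => PiTensorProduct.dualTprod_tprod _ _
  refine ⟨Λ, fun t ht => ?_, fun a b => ⟨PiTensorProduct.tprod K (v a b), fun g => ?_⟩⟩
  · induction ht using Submodule.span_induction with
    | zero => simp only [map_zero]; exact zero_mem _
    | add x y _ _ hx hy => simp only [map_add]; exact add_mem hx hy
    | smul s x _ hx =>
      have : (fun g => Λ ((ρ.prod (slStandard K (ι → K))).tensorPow (d + m) g (s • x))) =
          s • fun g => Λ ((ρ.prod (slStandard K (ι → K))).tensorPow (d + m) g x) := by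
        funext g
        rw [LinearMap.map_smul_of_tower, LinearMap.map_smul_of_tower, Pi.smul_apply]
      rw [this]
      exact Subalgebra.smul_mem _ hx s
    | mem t ht =>
      obtain ⟨w, hw, rfl⟩ := ht
      have hrat : ∀ ψ : Module.Dual K (L × (ι → K)),
          (∀ w ∈ L₀.prod (piRational k K ι), ψ w ∈ Set.range (algebraMap k K)) →
          ∀ w ∈ L₀.prod (piRational k K ι),
            (fun g => ψ ((ρ.prod (slStandard K (ι → K))) g w)) ∈
              (slPiFunctions k K ι).rational := by
        intro ψ hψ w hw
        obtain ⟨s, hs⟩ := hψ (w.1, 0) ⟨hw.1, zero_mem _⟩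
        have : (fun g => ψ ((ρ.prod (slStandard K (ι → K))) g w)) =
            algebraMap k _ s + fun g => (ψ.comp (LinearMap.inr K L (ι → K))) (g w.2) := by
          funext g
          change _ = algebraMap k K s + ψ (0, g w.2)
          rw [hact, hs, ← map_add, Prod.mk_add_mk, add_zero, zero_add]
        rw [this]
        refine add_mem (Subalgebra.algebraMap_mem _ _) (Algebra.subset_adjoin
          ⟨_, _, hw.2, fun u hu => hψ (0, u) ⟨zero_mem _, hu⟩, rfl⟩)
      have hform : ∀ a, ∀ w ∈ L₀.prod (piRational k K ι),
          form a w ∈ Set.range (algebraMap k K) := by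
        rintro (_ | i) w hw
        · exact hc _ _ hw.1
        · exact mem_piRational.1 hw.2 i
      have hφ : ∀ a i, ∀ w ∈ L₀.prod (piRational k K ι),
          φ a i w ∈ Set.range (algebraMap k K) := by
        intro a i w hw
        induction i using Fin.addCases with
        | left i => simp only [φ, Fin.append_left]; exact hform _ w hw
        | right i => simp only [φ, Fin.append_right]; exact hc _ _ hw.1
      have : (fun g => Λ ((ρ.prod (slStandard K (ι → K))).tensorPow (d + m) g
          (PiTensorProduct.tprod K w))) =
          ∑ a, ∏ i, fun g => φ a i ((ρ.prod (slStandard K (ι → K))) g (w i)) := by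
        funext g
        simp only [hΛ, Finset.sum_apply, Finset.prod_apply]
      rw [this]
      exact sum_mem fun a _ => prod_mem fun i _ => hrat _ (hφ a i) _ (hw i)
  · rw [hΛ, Finset.sum_eq_single a]
    · rw [Fin.prod_univ_add]
      simp only [φ, v, Fin.append_left, Fin.append_right, hcoeff]
      refine (congrArg₂ (· * ·) rfl (Finset.prod_eq_one fun i _ => ?_)).trans (mul_one _)
      rw [hact]
      exact (hcl _ _).trans (if_pos rfl)
    · intro a' _ ha'
      refine Finset.prod_eq_zero (Finset.mem_univ (Fin.natAdd d ⟨code a, hcode_lt a⟩)) ?_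
      simp only [φ, v, Fin.append_right]
      rw [hact]
      refine (hcl _ _).trans (if_neg ?_)
      simpa using fun h => ha' (hcode h).symm
    · exact fun h => (h (Finset.mem_univ a)).elim

end

theorem proposition5 {k : Type u} {K : Type v} [Field k] [Field K] [Algebra k K] [IsAlgClosed K]
    {G : Type w} [Group G] (A : FunctionAlgebras k K G) (hA : A.IsAlgebraicKGroup) :
    ∃ (U : Type v) (_ : AddCommGroup U) (_ : Module k U) (_ : Module K U)
      (_ : IsScalarTower k K U) (_ : FiniteDimensional K U)
      (U₀ : Submodule k U) (_ : IsKStructure U₀ (⊤ : Submodule K U)) (b : ℕ),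
      ∀ r : ℕ, b ≤ r →
      ∀ (L : Type x) [AddCommGroup L] [Module k L] [Module K L] [IsScalarTower k K L]
        [FiniteDimensional K L] (L₀ : Submodule k L),
        IsKStructure L₀ (⊤ : Submodule K L) →
      ∀ ρ : Representation K (SpecialLinearGroup K U) L, ρ.IsTrivial →
        2 ≤ Module.finrank K L →
        ∃ S : Submodule K (⨂[K] _ : Fin r, L × U),
          IsDefinedOver (tensorPowRational K (L₀.prod U₀) r) S ∧
          (slFunctions U₀).IsKSubgroup
            (((ρ.prod (slStandard K U)).tensorPow r).normalizer S) ∧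
          ∃ φ : (((ρ.prod (slStandard K U)).tensorPow r).normalizer S) ≃* G,
            FunctionAlgebras.IsKIsomorphism
              ((slFunctions U₀).restrict
                ((((ρ.prod (slStandard K U)).tensorPow r).normalizer S : Subgroup _) : Set _))
              A φ := by
  obtain ⟨ι, _, _, σ, hσ⟩ := hA.exists_isClosedKEmbedding
  obtain ⟨s, hs, hzero⟩ := hσ.exists_finset_zeros hA.toIsAffineKVariety
  obtain ⟨d, hd⟩ := exists_common_degree (k := k) s fun f hf => (hs f hf).1
  refine ⟨ι → K, inferInstance, inferInstance, inferInstance, inferInstance, inferInstance,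
    piRational k K ι, isKStructure_piRational, d + Fintype.card (Fin d → Option ι), ?_⟩
  intro r hr L _ _ _ _ _ L₀ hL₀ ρ hρ hL
  obtain ⟨m, rfl⟩ := Nat.exists_eq_add_of_le ((Nat.le_add_right _ _).trans hr)
  obtain ⟨Λ, hΛ, hΛmon⟩ := exists_rational_form d m (Nat.le_of_add_le_add_left hr) hL₀ ρ hρ hL
  set τ := (ρ.prod (slStandard K (ι → K))).tensorPow (d + m)
  have hΛs : ∀ f ∈ s, ∃ t, ∀ g, Λ (τ g t) = f g := by
    intro f hf
    have h := hd f hf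
    clear hf
    induction h using Submodule.span_induction with
    | zero => exact ⟨0, fun g => by rw [map_zero, map_zero]; rfl⟩
    | add f f' _ _ hf hf' =>
      obtain ⟨t, ht⟩ := hf
      obtain ⟨t', ht'⟩ := hf'
      exact ⟨t + t', fun g => by rw [map_add, map_add, ht, ht']; rfl⟩
    | smul c f _ hf =>
      obtain ⟨t, ht⟩ := hf
      exact ⟨c • t, fun g => by rw [map_smul, map_smul, ht]; rfl⟩
    | mem f hf =>
      obtain ⟨a, b, rfl⟩ := hf
      exact hΛmon a b
  let T : (⨂[K] _ : Fin (d + m), L × (ι → K)) →ₗ[K] (G → K) :=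
    LinearMap.pi fun g => Λ.comp (τ (σ g))
  have hT : ∀ t, t ∈ LinearMap.ker T ↔ ∀ g, Λ (τ (σ g) t) = 0 := fun t =>
    LinearMap.mem_ker.trans funext_iff
  have hle : ∀ h, (LinearMap.ker T).map (τ (σ h)) ≤ LinearMap.ker T := by
    rintro h _ ⟨t, ht, rfl⟩
    refine (hT _).2 fun g => ?_
    have := (hT t).1 ht (g * h)
    rwa [map_mul, map_mul] at this
  have hnorm : τ.normalizer (LinearMap.ker T) = σ.range := by
    ext x
    constructor
    · intro hx
      refine hzero x fun f hf => ?_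
      obtain ⟨t, ht⟩ := hΛs f hf
      have htT : t ∈ LinearMap.ker T := (hT t).2 fun g => by rw [ht, (hs f hf).2]
      have hx' : (LinearMap.ker T).map (τ x) = LinearMap.ker T := hx
      have := (hT _).1 (hx'.le ⟨t, htT, rfl⟩) 1
      rwa [map_one, map_one, Module.End.one_apply, ht] at this
    · rintro ⟨h, rfl⟩
      refine le_antisymm (hle h) fun t ht => ⟨τ (σ h⁻¹) t, hle h⁻¹ ⟨t, ht, rfl⟩, ?_⟩
      rw [← Module.End.mul_apply, ← map_mul, ← map_mul, mul_inv_cancel, map_one, map_one,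
        Module.End.one_apply]
  refine ⟨LinearMap.ker T, ?_, ?_, ?_⟩
  · refine le_antisymm (Submodule.span_le.2 Set.inter_subset_right) fun t ht => ?_
    have hspan := span_tensorPowRational (span_prod_eq_top hL₀.span_eq
      (isKStructure_piRational (k := k) (K := K) (ι := ι)).span_eq) (d + m)
    exact mem_span_inter_ker hA.isKStructure.injective T
      (fun t ht => hσ.comp_mem_rational (hΛ t ht)) (hspan ▸ Submodule.mem_top) ht
  · rw [hnorm]
    exact hσ.isKSubgroup_range hA.toIsAffineKVariety
  · exact hσ.exists_isKIsomorphism hA.toIsAffineKVariety hnorm
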